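/- Let $f:\mathbb{R}^d\to\mathbb{R}^d$ ($d\ge 1$) be locally Lipschitz, let $\sigma\in\mathbb{R}^{d\times m}$, and consider $dX_t=f(X_t)\,dt+\sigma\,dB_t$ with $B$ a standard $m$-dimensional Brownian motion. Let $\mu$ be an invariant probability law of this equation (for instance its ergodic measure), and let $(X^{(r)},B^{(r)})$, $r=1,\dots,M$, $M\ge 1$, be independent trajectories, each $X^{(r)}$ being a global solution driven by $B^{(r)}$ with $X^{(r)}_0\sim\mu$. For $\delta>0$ put $t_n=n\delta$ and $\Delta B_{t_n}=B_{t_{n+1}}-B_{t_n}$. A parametric form is a family $F^\delta(c;x,\xi)$ with components $F^\delta_k(c;x,\xi)=\sum_{i=0}^p c_{i,k}\,\phi_i^k(x,\xi)$, $k=1,\dots,d$, where the $\phi_i=\phi_i^\delta:\mathbb{R}^d\times\mathbb{R}^m\to\mathbb{R}^d$ are measurable. It parametrizes the explicit scheme $X_{n+1}=X_n+\delta F^\delta(X_n,\xi_n)$ if, for every $\delta>0$, there is $c^*$ with $F^\delta(x,\xi)=F^\delta(c^*;x,\xi)$ for all $x,\xi$. From $N\ge1$ steps of each trajectory the coefficients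 are estimated componentwise by least squares, $\hat c_{\cdot,k}=\bar A_k^{+}\bar b_k$, where $^+$ is the Moore--Penrose pseudo-inverse and $$\bar A_k(i,j)=\frac1{MN}\sum_{r=1}^M\sum_{n=0}^{N-1}\phi_i^k\phi_j^k,\qquad \bar b_k(i)=\frac1{MN}\sum_{r=1}^M\sum_{n=0}^{N-1}\frac{X^{(r),k}_{t_{n+1}}-X^{(r),k}_{t_n}}{\delta}\,\phi_i^k,$$ the $\phi$'s being evaluated at $(X^{(r)}_{t_n},\Delta B^{(r)}_{t_n})$. The estimated residual variances, of the components and of the whole scheme, are $$\hat\sigma_k^2=\frac1{\delta^2MN}\sum_{r=1}^M\sum_{n=0}^{N-1}\bigl|X^{(r),k}_{t_{n+1}}-X^{(r),k}_{t_n}-\delta F_k^\delta(\hat c;X^{(r)}_{t_n},\Delta B^{(r)}_{t_n})\bigr|^2,$$ $$\hat\sigma^2=\frac{2}{d\,\delta^2MN}\sum_{r=1}^M\sum_{n=0}^{N-1}\bigl|X^{(r)}_{t_{n+1}}-X^{(r)}_{t_n}-\delta F^\delta(\hat c;X^{(r)}_{t_n},\Delta B^{(r)}_{t_n})\bigr|^2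 .$$ If the parametric form parametrizes an explicit scheme with flow map $F^\delta$, then for all $\delta>0$ and $N\ge 1$, all $n\ge 0$ and every trajectory $(X,B)=(X^{(r)},B^{(r)})$, $\hat\sigma_k^2$ and $\hat\sigma^2$ are random variables and (with expectations in $[0,\infty]$) $$\mathbb{E}\,\hat\sigma^2\le\frac2d\,\mathbb{E}\Bigl[\Bigl|\frac{X_{t_{n+1}}-X_{t_n}}{\delta}-F^\delta(X_{t_n},\Delta B_{t_n})\Bigr|^2\Bigr],$$ and, for every component $k$, $$\mathbb{E}\,\hat\sigma_k^2\le\mathbb{E}\Bigl[\Bigl|\frac{X^k_{t_{n+1}}-X^k_{t_n}}{\delta}-F_k^\delta(X_{t_n},\Delta B_{t_n})\Bigr|^2\Bigr].$$ Hence the inferred scheme has at least the one-step strong order of the explicit scheme: for every $\gamma\in\mathbb{R}$, if $\mathbb{E}\bigl[|(X_{t_{n+1}}-X_{t_n})/\delta-F^\delta(X_{t_n},\Delta B_{t_n})|^2\bigr]^{1/2}=O(\delta^\gamma)$ as $\delta\downarrow0$ (for some fixed $n$ and trajectory), then $(\mathbb{E}\,\hat\sigma^2)^{1/2}=O(\delta^\gamma)$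 as $\delta\downarrow 0$, for any choice of the sample length $N=N(\delta)\ge1$. This applies to IS-EM, with basis $x,\ f(x),\ \sigma\xi/\delta$, which parametrizes the Euler--Maruyama flow map $f(x)+\sigma\xi/\delta$, and to IS-RK4, with basis $x,\ \varphi(x,\xi),\ \sigma\xi/\delta$, where $\varphi=(k_1+2k_2+2k_3+k_4)/6$ is the standard Runge--Kutta increment with constant force $g=\sigma\xi/\delta$, that is, $k_1=f(x)+g$, $k_2=f(x+\tfrac\delta2k_1)+g$, $k_3=f(x+\tfrac\delta2k_2)+g$, $k_4=f(x+\delta k_3)+g$; it parametrizes the flow map $\varphi$, and also $\varphi+\sigma\xi/\delta$. -/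

import Mathlib

open MeasureTheory ProbabilityTheory Filter Topology
open scoped NNReal ENNReal

universe u

/-! ### Moore-Penrose pseudo-inverse of a square real matrix -/

/-- The four Penrose equations: `P` is the Moore-Penrose pseudo-inverse of `A`. -/
structure IsMoorePenrose {n : Type*} [Fintype n] (A P : Matrix n n ℝ) : Prop where
  mul_mul_left : A * P * A = A
  mul_mul_right : P * A * P = P
  left_symm : (A * P).transpose = A * P
  right_symm : (P * A).transpose = P * A

theorem exists_isMoorePenrose_of_isHermitian {n : Type*} [Fintype n] [DecidableEq n]
    {H : Matrix n n ℝ} (hH : H.IsHermitian) :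
    ∃ S : Matrix n n ℝ, IsMoorePenrose H S ∧ S.transpose = S := by
  obtain ⟨U, D, hU, hU', hHD⟩ : ∃ (U : Matrix n n ℝ) (D : n → ℝ),
      U.transpose * U = 1 ∧ U * U.transpose = 1 ∧
        H = U * Matrix.diagonal D * U.transpose := by
    refine ⟨hH.eigenvectorUnitary, hH.eigenvalues, ?_, ?_, ?_⟩
    · have := (Matrix.mem_unitaryGroup_iff'.1 hH.eigenvectorUnitary.2)
      simpa [Matrix.star_eq_conjTranspose] using this
    · have := (Matrix.mem_unitaryGroup_iff.1 hH.eigenvectorUnitary.2)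
      simpa [Matrix.star_eq_conjTranspose] using this
    · have := hH.spectral_theorem
      simpa [Unitary.conjStarAlgAut_apply, Matrix.star_eq_conjTranspose,
        Function.comp_def] using this
  have key : ∀ a b : n → ℝ, U * Matrix.diagonal a * U.transpose *
      (U * Matrix.diagonal b * U.transpose) =
      U * Matrix.diagonal (fun i => a i * b i) * U.transpose := by
    intro a b
    calc _ = U * Matrix.diagonal a * (U.transpose * U) * Matrix.diagonal b * U.transpose := by
            simp only [Matrix.mul_assoc]
      _ = _ := by
            rw [hU, Matrix.mul_one, Matrix.mul_assoc U, Matrix.diagonal_mul_diagonal]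
  have tr : ∀ a : n → ℝ, (U * Matrix.diagonal a * U.transpose).transpose =
      U * Matrix.diagonal a * U.transpose := by
    intro a
    simp [Matrix.transpose_mul, Matrix.mul_assoc]
  refine ⟨U * Matrix.diagonal (fun i => (D i)⁻¹) * U.transpose, ⟨?_, ?_, ?_, ?_⟩, tr _⟩
  · rw [hHD, key, key]
    congr 3; ext i; simp
  · rw [hHD, key, key]
    congr 3; ext i
    by_cases h : D i = 0 <;> simp [h]
  · rw [hHD, key, tr]
  · rw [hHD, key, tr]

theorem exists_isMoorePenrose {n : Type*} [Fintype n] [DecidableEq n] (A : Matrix n n ℝ) :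
    ∃ P : Matrix n n ℝ, IsMoorePenrose A P := by
  have hH : (A.transpose * A).IsHermitian := by
    simpa using Matrix.isHermitian_conjTranspose_mul_self A
  obtain ⟨S, hS, hSt⟩ := exists_isMoorePenrose_of_isHermitian hH
  refine ⟨S * A.transpose, ⟨?_, ?_, ?_, ?_⟩⟩
  · have h0 : (A * S * (A.transpose * A) - A).transpose *
        (A * S * (A.transpose * A) - A) = 0 := by
      have h1 := hS.mul_mul_left
      simp only [Matrix.transpose_sub, Matrix.transpose_mul, Matrix.transpose_transpose, hSt,
        Matrix.sub_mul, Matrix.mul_sub, Matrix.mul_assoc] at h1 ⊢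
      simp only [← Matrix.mul_assoc] at h1 ⊢
      simp [h1]
    have h2 : A * S * (A.transpose * A) - A = 0 := by
      rw [← Matrix.conjTranspose_eq_transpose_of_trivial] at h0
      exact Matrix.conjTranspose_mul_self_eq_zero.1 h0
    have h3 := sub_eq_zero.1 h2
    simpa only [Matrix.mul_assoc] using h3
  · have := congrArg (· * A.transpose) hS.mul_mul_right
    simpa only [Matrix.mul_assoc] using this
  · simp [Matrix.transpose_mul, hSt, Matrix.mul_assoc]
  · simpa only [Matrix.mul_assoc] using hS.right_symm

/-- The Moore-Penrose pseudo-inverse `A⁺`, the (unique) solution of the Penrose equations. -/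
noncomputable def pseudoInverse {n : Type*} [Fintype n] [DecidableEq n] (A : Matrix n n ℝ) :
    Matrix n n ℝ :=
  (exists_isMoorePenrose A).choose

/-! ### The stochastic differential equation `dX = f(X) dt + σ dB` -/

/-- The vector `σ ξ` in the state space, for `ξ` in the noise space. -/
noncomputable def noiseTerm {d m : ℕ} (σ : Matrix (Fin d) (Fin m) ℝ)
    (ξ : EuclideanSpace ℝ (Fin m)) : EuclideanSpace ℝ (Fin d) :=
  WithLp.toLp 2 (σ.mulVec (WithLp.ofLp ξ))

/-- `B` is a standard `m`-dimensional Brownian motion relative to the filtration `ℱ`. -/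
structure IsFilteredBrownian {Ω : Type*} [mΩ : MeasurableSpace Ω] {m : ℕ} (P : Measure Ω)
    (ℱ : Filtration ℝ≥0 mΩ) (B : ℝ≥0 → Ω → EuclideanSpace ℝ (Fin m)) : Prop where
  isBrownianReal_coord : ∀ k : Fin m, IsBrownianReal (fun t ω => B t ω k) P
  indep_coord : iIndepFun (fun (k : Fin m) (ω : Ω) (t : ℝ≥0) => B t ω k) P
  adapted : Adapted ℱ B
  indep_increment : ∀ s t : ℝ≥0, s ≤ t →
    Indep (MeasurableSpace.comap (fun ω => B t ω - B s ω) inferInstance) (ℱ s) P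

/-- `X` is a global solution of `dX = f(X) dt + σ dB`: it is adapted, has continuous paths, and
`X_t = X_0 + ∫_0^t f(X_s) ds + σ B_t` for all `t ≥ 0`, almost surely. (The noise is additive, so
that `∫_0^t σ dB_s = σ B_t`.) -/
structure IsSDESolution {Ω : Type*} [mΩ : MeasurableSpace Ω] {d m : ℕ}
    (f : EuclideanSpace ℝ (Fin d) → EuclideanSpace ℝ (Fin d)) (σ : Matrix (Fin d) (Fin m) ℝ)
    (P : Measure Ω) (ℱ : Filtration ℝ≥0 mΩ) (B : ℝ≥0 → Ω → EuclideanSpace ℝ (Fin m))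
    (X : ℝ≥0 → Ω → EuclideanSpace ℝ (Fin d)) : Prop where
  brownian : IsFilteredBrownian P ℱ B
  adapted : Adapted ℱ X
  continuous_paths : ∀ᵐ ω ∂P, Continuous fun t => X t ω
  integral_eq : ∀ᵐ ω ∂P, ∀ t : ℝ≥0,
    X t ω = X 0 ω + (∫ s in (0 : ℝ)..t, f (X s.toNNReal ω)) + noiseTerm σ (B t ω)

/-- `μ` is an invariant law of the equation: a solution whose initial value has law `μ` has
law `μ` at every time. -/
def IsInvariantLaw {d m : ℕ} (f : EuclideanSpace ℝ (Fin d) → EuclideanSpace ℝ (Fin d))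
    (σ : Matrix (Fin d) (Fin m) ℝ) (μ : Measure (EuclideanSpace ℝ (Fin d))) : Prop :=
  ∀ (Ω : Type u) (mΩ : MeasurableSpace Ω) (P : Measure Ω) (_ : IsProbabilityMeasure P)
    (ℱ : Filtration ℝ≥0 mΩ) (B : ℝ≥0 → Ω → EuclideanSpace ℝ (Fin m))
    (X : ℝ≥0 → Ω → EuclideanSpace ℝ (Fin d)),
    IsSDESolution f σ P ℱ B X → P.map (X 0) = μ → ∀ t : ℝ≥0, P.map (X t) = μ

/-- The observations are made on `M` independent trajectories `(X^r, B^r)` of the equation, all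
started from the law `μ`. -/
structure IsTrajectorySample {Ω : Type*} [mΩ : MeasurableSpace Ω] {d m M : ℕ}
    (f : EuclideanSpace ℝ (Fin d) → EuclideanSpace ℝ (Fin d)) (σ : Matrix (Fin d) (Fin m) ℝ)
    (μ : Measure (EuclideanSpace ℝ (Fin d))) (P : Measure Ω)
    (ℱ : Fin M → Filtration ℝ≥0 mΩ) (B : Fin M → ℝ≥0 → Ω → EuclideanSpace ℝ (Fin m))
    (X : Fin M → ℝ≥0 → Ω → EuclideanSpace ℝ (Fin d)) : Prop where
  solution : ∀ r, IsSDESolution f σ P (ℱ r) (B r) (X r)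
  initial : ∀ r, P.map (X r 0) = μ
  indep : iIndepFun (fun (r : Fin M) (ω : Ω) (t : ℝ≥0) => (X r t ω, B r t ω)) P

/-! ### Flow maps, explicit schemes and their linear parametrizations -/

/-- `(X_{t_{n+1}} - X_{t_n}) / δ` with `t_n = n δ`. -/
noncomputable def flowIncrement {Ω : Type*} {d : ℕ} (X : ℝ≥0 → Ω → EuclideanSpace ℝ (Fin d))
    (δ : ℝ≥0) (n : ℕ) (ω : Ω) : EuclideanSpace ℝ (Fin d) :=
  (δ : ℝ)⁻¹ • (X ((n + 1) * δ) ω - X (n * δ) ω)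

/-- `ΔB_{t_n} = B_{t_{n+1}} - B_{t_n}` with `t_n = n δ`. -/
noncomputable def noiseIncrement {Ω : Type*} {m : ℕ} (B : ℝ≥0 → Ω → EuclideanSpace ℝ (Fin m))
    (δ : ℝ≥0) (n : ℕ) (ω : Ω) : EuclideanSpace ℝ (Fin m) :=
  B ((n + 1) * δ) ω - B (n * δ) ω

/-- The one-step map of a scheme `X_{n+1} = X_n + δ F^δ(X_n, ξ_n)`, for each time step `δ`. -/
abbrev FlowMap (d m : ℕ) : Type :=
  ℝ≥0 → EuclideanSpace ℝ (Fin d) → EuclideanSpace ℝ (Fin m) → EuclideanSpace ℝ (Fin d)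

/-- The parametric flow map `∑ i, c_i φ_i(x, ξ)`, with one set of coefficients for each
component of the state. -/
noncomputable def parametricFlow {d m p : ℕ} (φ : Fin (p + 1) → FlowMap d m)
    (c : Fin (p + 1) → Fin d → ℝ) : FlowMap d m :=
  fun δ x ξ => WithLp.toLp 2 fun k => ∑ i, c i k * φ i δ x ξ k

/-- The parametric form with basis `φ` parametrizes the explicit scheme with flow map `F`: the
basis functions are measurable and `F^δ` is a member of the parametric family. -/
def Parametrizes {d m p : ℕ} (φ : Fin (p + 1) → FlowMap d m) (F : FlowMap d m) : Prop :=
  ∀ δ : ℝ≥0, 0 < δ →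
    (∀ i, Measurable fun z : EuclideanSpace ℝ (Fin d) × EuclideanSpace ℝ (Fin m) =>
      φ i δ z.1 z.2) ∧
    ∃ c : Fin (p + 1) → Fin d → ℝ, ∀ x ξ, F δ x ξ = parametricFlow φ c δ x ξ

/-- Flow map of the Euler-Maruyama scheme. -/
noncomputable def emFlow {d m : ℕ} (f : EuclideanSpace ℝ (Fin d) → EuclideanSpace ℝ (Fin d))
    (σ : Matrix (Fin d) (Fin m) ℝ) : FlowMap d m :=
  fun δ x ξ => f x + (δ : ℝ)⁻¹ • noiseTerm σ ξ

/-- Basis of IS-EM: the state, and the two terms of the Euler-Maruyama flow map. -/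
noncomputable def emBasis {d m : ℕ} (f : EuclideanSpace ℝ (Fin d) → EuclideanSpace ℝ (Fin d))
    (σ : Matrix (Fin d) (Fin m) ℝ) : Fin (2 + 1) → FlowMap d m :=
  ![fun _ x _ => x, fun _ x _ => f x, fun δ _ ξ => (δ : ℝ)⁻¹ • noiseTerm σ ξ]

/-- `φ₁(x, σξ)`: the standard fourth-order Runge-Kutta increment for the drift `f`, with the
stochastic force `σξ/δ` treated as a constant input. -/
noncomputable def rk4Increment {d m : ℕ}
    (f : EuclideanSpace ℝ (Fin d) → EuclideanSpace ℝ (Fin d))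
    (σ : Matrix (Fin d) (Fin m) ℝ) : FlowMap d m :=
  fun δ x ξ =>
    let g := (δ : ℝ)⁻¹ • noiseTerm σ ξ
    let k₁ := f x + g
    let k₂ := f (x + ((δ : ℝ) / 2) • k₁) + g
    let k₃ := f (x + ((δ : ℝ) / 2) • k₂) + g
    let k₄ := f (x + (δ : ℝ) • k₃) + g
    (1 / 6 : ℝ) • (k₁ + (2 : ℝ) • k₂ + (2 : ℝ) • k₃ + k₄)

/-- The flow map `φ₁(x, σξ) + σξ/δ`, in which the stochastic force is added once more to the
Runge-Kutta increment. -/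
noncomputable def rk4AddNoiseFlow {d m : ℕ}
    (f : EuclideanSpace ℝ (Fin d) → EuclideanSpace ℝ (Fin d))
    (σ : Matrix (Fin d) (Fin m) ℝ) : FlowMap d m :=
  fun δ x ξ => rk4Increment f σ δ x ξ + (δ : ℝ)⁻¹ • noiseTerm σ ξ

/-- Basis of IS-RK4: the state, the Runge-Kutta increment, and the stochastic force. -/
noncomputable def rk4Basis {d m : ℕ} (f : EuclideanSpace ℝ (Fin d) → EuclideanSpace ℝ (Fin d))
    (σ : Matrix (Fin d) (Fin m) ℝ) : Fin (2 + 1) → FlowMap d m :=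
  ![fun _ x _ => x, rk4Increment f σ, fun δ _ ξ => (δ : ℝ)⁻¹ • noiseTerm σ ξ]

/-! ### Least squares inference of the coefficients, and the residual -/

/-- The normal matrix `Ā_k`, for the `k`-th component of the state. -/
noncomputable def normalMatrix {Ω : Type*} {d m p M : ℕ} (φ : Fin (p + 1) → FlowMap d m)
    (B : Fin M → ℝ≥0 → Ω → EuclideanSpace ℝ (Fin m))
    (X : Fin M → ℝ≥0 → Ω → EuclideanSpace ℝ (Fin d)) (δ : ℝ≥0) (N : ℕ) (k : Fin d) (ω : Ω) :
    Matrix (Fin (p + 1)) (Fin (p + 1)) ℝ :=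
  Matrix.of fun i j => 1 / ((M : ℝ) * N) * ∑ r : Fin M, ∑ n ∈ Finset.range N,
    φ i δ (X r (n * δ) ω) (noiseIncrement (B r) δ n ω) k *
      φ j δ (X r (n * δ) ω) (noiseIncrement (B r) δ n ω) k

/-- The normal vector `b̄_k`, for the `k`-th component of the state. -/
noncomputable def normalVector {Ω : Type*} {d m p M : ℕ} (φ : Fin (p + 1) → FlowMap d m)
    (B : Fin M → ℝ≥0 → Ω → EuclideanSpace ℝ (Fin m))
    (X : Fin M → ℝ≥0 → Ω → EuclideanSpace ℝ (Fin d)) (δ : ℝ≥0) (N : ℕ) (k : Fin d) (ω : Ω) :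
    Fin (p + 1) → ℝ :=
  fun i => 1 / ((M : ℝ) * N) * ∑ r : Fin M, ∑ n ∈ Finset.range N,
    flowIncrement (X r) δ n ω k * φ i δ (X r (n * δ) ω) (noiseIncrement (B r) δ n ω) k

/-- The least squares estimator `ĉ_k = (Ā_k)⁺ b̄_k`, for every component `k`. -/
noncomputable def estimator {Ω : Type*} {d m p M : ℕ} (φ : Fin (p + 1) → FlowMap d m)
    (B : Fin M → ℝ≥0 → Ω → EuclideanSpace ℝ (Fin m))
    (X : Fin M → ℝ≥0 → Ω → EuclideanSpace ℝ (Fin d)) (δ : ℝ≥0) (N : ℕ) (ω : Ω) :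
    Fin (p + 1) → Fin d → ℝ :=
  fun i k => (pseudoInverse (normalMatrix φ B X δ N k ω)).mulVec
    (normalVector φ B X δ N k ω) i

/-- The estimated residual variance of the `k`-th component. -/
noncomputable def residualVarianceCoord {Ω : Type*} {d m p M : ℕ}
    (φ : Fin (p + 1) → FlowMap d m) (B : Fin M → ℝ≥0 → Ω → EuclideanSpace ℝ (Fin m))
    (X : Fin M → ℝ≥0 → Ω → EuclideanSpace ℝ (Fin d)) (δ : ℝ≥0) (N : ℕ) (k : Fin d) (ω : Ω) :
    ℝ :=
  1 / (δ : ℝ) ^ 2 * (1 / ((M : ℝ) * N)) * ∑ r : Fin M, ∑ n ∈ Finset.range N,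
    ((X r ((n + 1) * δ) ω - X r (n * δ) ω - (δ : ℝ) • parametricFlow φ
      (estimator φ B X δ N ω) δ (X r (n * δ) ω) (noiseIncrement (B r) δ n ω)) k) ^ 2

/-- The estimated residual variance of the inferred scheme. -/
noncomputable def residualVariance {Ω : Type*} {d m p M : ℕ}
    (φ : Fin (p + 1) → FlowMap d m) (B : Fin M → ℝ≥0 → Ω → EuclideanSpace ℝ (Fin m))
    (X : Fin M → ℝ≥0 → Ω → EuclideanSpace ℝ (Fin d)) (δ : ℝ≥0) (N : ℕ) (ω : Ω) : ℝ :=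
  2 / (d * (δ : ℝ) ^ 2) * (1 / ((M : ℝ) * N)) * ∑ r : Fin M, ∑ n ∈ Finset.range N,
    ‖X r ((n + 1) * δ) ω - X r (n * δ) ω - (δ : ℝ) • parametricFlow φ
      (estimator φ B X δ N ω) δ (X r (n * δ) ω) (noiseIncrement (B r) δ n ω)‖ ^ 2

/-- `E |(X_{t_{n+1}} - X_{t_n})/δ - F^δ(X_{t_n}, ΔB_{t_n})|²`, an element of `[0, ∞]`. -/
noncomputable def oneStepError {Ω : Type*} [MeasurableSpace Ω] {d m : ℕ} (F : FlowMap d m)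
    (P : Measure Ω) (B : ℝ≥0 → Ω → EuclideanSpace ℝ (Fin m))
    (X : ℝ≥0 → Ω → EuclideanSpace ℝ (Fin d)) (δ : ℝ≥0) (n : ℕ) : ℝ≥0∞ :=
  ∫⁻ ω, ‖flowIncrement X δ n ω - F δ (X (n * δ) ω) (noiseIncrement B δ n ω)‖ₑ ^ 2 ∂P

/-- The contribution of the `k`-th component to `oneStepError`. -/
noncomputable def oneStepErrorCoord {Ω : Type*} [MeasurableSpace Ω] {d m : ℕ}
    (F : FlowMap d m) (P : Measure Ω) (B : ℝ≥0 → Ω → EuclideanSpace ℝ (Fin m))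
    (X : ℝ≥0 → Ω → EuclideanSpace ℝ (Fin d)) (δ : ℝ≥0) (n : ℕ) (k : Fin d) : ℝ≥0∞ :=
  ∫⁻ ω, ‖(flowIncrement X δ n ω - F δ (X (n * δ) ω) (noiseIncrement B δ n ω)) k‖ₑ ^ 2 ∂P

/-- A mean-square one-step error `e(δ)` (of the flow map) has strong order `γ`: its root is
`O(δ^γ)` as the time step `δ` decreases to `0`. -/
def HasOneStepStrongOrder (e : ℝ≥0 → ℝ≥0∞) (γ : ℝ) : Prop :=
  ∃ C : ℝ≥0, ∀ᶠ δ in 𝓝[>] (0 : ℝ≥0), e δ ≤ ((C * δ ^ (2 * γ) : ℝ≥0) : ℝ≥0∞)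

/-! ### Least squares -/

/-! For each ω, the coefficients obtained from the pseudo-inverse solve the normal equations
(`normal_equations`), hence minimize the empirical residual over all coefficients. In particular
they do no worse than the coefficients c* of the explicit scheme, for which the empirical residual
is the average over the MN observed transitions of the squared one-step error of F. Taking
expectations leaves an average of MN one-step errors (`lintegral_residualVarianceCoord_le`).
Everything is nonnegative, so no integrability is needed.

These errors are all equal. Each is a functional of the triple (X_t, X_{t+δ}, B_{t+δ} - B_t), while
invariance of μ gives only the law of X_t. What is missing is a uniqueness in law including the
noise: the law of the triple depends only on that of X_t (`map_transition_eq`). Since the noise is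
additive, X_{t+δ} is the limit, path by path, of Euler schemes driven by the observed noise
(`tendsto_eulerScheme`); a local Lipschitz condition suffices because a single path on a bounded
interval stays in a ball. The Euler scheme, together with its starting point and accumulated noise,
is a Markov chain whose kernel is the same for all trajectories and times (`map_eulerChain_succ`),
so its law depends only on the initial one, and equality of laws passes to the limit.

The pseudo-inverse comes from a choice, so measurability of the estimator is avoided altogether: the
minimal residual is an infimum over a countable dense set of coefficients. -/

theorem isMoorePenrose_pseudoInverse {n : Type*} [Fintype n] [DecidableEq n] (A : Matrix n n ℝ) :
    IsMoorePenrose A (pseudoInverse A) :=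
  (exists_isMoorePenrose A).choose_spec

/-- Residual sum of squares of the linear model with regressors `a`, responses `y` and
coefficients `c`, over the sample `s`. -/
def residualSumSq {ι n : Type*} [Fintype n] (s : Finset ι) (a : ι → n → ℝ) (y : ι → ℝ)
    (c : n → ℝ) : ℝ :=
  ∑ z ∈ s, (y z - ∑ i, c i * a z i) ^ 2

theorem gram_mulVec {ι n : Type*} [Fintype n] (s : Finset ι) (a : ι → n → ℝ) (w : ℝ)
    (v : n → ℝ) (i : n) :
    (Matrix.of fun i j => w * ∑ z ∈ s, a z i * a z j).mulVec v i =
      w * ∑ z ∈ s, a z i * ∑ j, v j * a z j := by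
  simp only [Matrix.mulVec, dotProduct, Matrix.of_apply, Finset.mul_sum, Finset.sum_mul]
  rw [Finset.sum_comm]
  exact Finset.sum_congr rfl fun z _ => Finset.sum_congr rfl fun j _ => by ring

/-- A left annihilator of the Gram matrix annihilates every regressor. -/
theorem dotProduct_eq_zero_of_vecMul_gram {ι n : Type*} [Fintype n] (s : Finset ι)
    (a : ι → n → ℝ) {w : ℝ} (hw : w ≠ 0) (v : n → ℝ)
    (hv : Matrix.vecMul v (Matrix.of fun i j => w * ∑ z ∈ s, a z i * a z j) = 0) :
    ∀ z ∈ s, ∑ i, v i * a z i = 0 := by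
  have h1 : Matrix.mulVec (Matrix.of fun i j => w * ∑ z ∈ s, a z i * a z j) v = 0 := by
    rw [← Matrix.vecMul_transpose]
    rw [← hv]
    congr 1
    ext i j
    simp [mul_comm]
  -- The quadratic form of the Gram matrix at `v` is `w` times this sum of squares.
  have h2 : ∑ z ∈ s, (∑ i, v i * a z i) ^ 2 = 0 := by
    have h3 : ∑ i, v i * (w * ∑ z ∈ s, a z i * ∑ j, v j * a z j) = 0 := by
      refine Finset.sum_eq_zero fun i _ => ?_
      rw [← gram_mulVec, h1]
      simp
    have h4 : ∑ i, v i * (w * ∑ z ∈ s, a z i * ∑ j, v j * a z j) =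
        w * ∑ z ∈ s, (∑ i, v i * a z i) ^ 2 := by
      simp only [sq, Finset.mul_sum, Finset.sum_mul]
      rw [Finset.sum_comm]
      refine Finset.sum_congr rfl fun z _ => ?_
      rw [Finset.sum_comm]
      exact Finset.sum_congr rfl fun j _ => Finset.sum_congr rfl fun k _ => by ring
    rw [h4] at h3
    exact (mul_eq_zero.1 h3).resolve_left hw
  intro z hz
  exact pow_eq_zero_iff two_ne_zero |>.1
    ((Finset.sum_eq_zero_iff_of_nonneg fun z _ => sq_nonneg _).1 h2 z hz)

/-- The pseudo-inverse of the Gram matrix solves the normal equations. -/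
theorem normal_equations {ι n : Type*} [Fintype n] [DecidableEq n] (s : Finset ι)
    (a : ι → n → ℝ) (y : ι → ℝ) {w : ℝ} (hw : w ≠ 0) (c : n → ℝ)
    (hc : c = (pseudoInverse (Matrix.of fun i j => w * ∑ z ∈ s, a z i * a z j)).mulVec
      fun i => w * ∑ z ∈ s, y z * a z i) (i : n) :
    ∑ z ∈ s, (y z - ∑ j, c j * a z j) * a z i = 0 := by
  set A : Matrix n n ℝ := Matrix.of fun i j => w * ∑ z ∈ s, a z i * a z j with hA
  set b : n → ℝ := fun i => w * ∑ z ∈ s, y z * a z i with hb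
  have hP := (isMoorePenrose_pseudoInverse A).mul_mul_left
  -- By the first Penrose equation the rows of `1 - A * pseudoInverse A` annihilate `A`, hence every
  -- regressor, hence `b`, which is a combination of regressors. So `b` lies in the range of `A`,
  -- and `A c = b` even if `A` is singular.
  have hker : Matrix.vecMul ((1 - A * pseudoInverse A) i) A = 0 := by
    have h0 : (1 - A * pseudoInverse A) * A = 0 := by
      rw [Matrix.sub_mul, hP, Matrix.one_mul, sub_self]
    ext j
    exact congrFun (congrFun h0 i) j
  have hz := dotProduct_eq_zero_of_vecMul_gram s a hw _ hker
  have hbz : (1 - A * pseudoInverse A).mulVec b i = 0 := by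
    have : (1 - A * pseudoInverse A).mulVec b i =
        w * ∑ z ∈ s, y z * ∑ j, (1 - A * pseudoInverse A) i j * a z j := by
      simp only [Matrix.mulVec, dotProduct, hb, Finset.mul_sum]
      rw [Finset.sum_comm]
      exact Finset.sum_congr rfl fun z _ => Finset.sum_congr rfl fun j _ => by ring
    rw [this, Finset.sum_eq_zero fun z hz' => by rw [hz z hz', mul_zero], mul_zero]
  have hAc : A.mulVec c i = b i := by
    rw [Matrix.sub_mulVec, Matrix.one_mulVec, ← Matrix.mulVec_mulVec, ← hc] at hbz
    exact (sub_eq_zero.1 hbz).symm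
  rw [hA, gram_mulVec] at hAc
  have h5 := mul_left_cancel₀ hw hAc
  calc ∑ z ∈ s, (y z - ∑ j, c j * a z j) * a z i
      = ∑ z ∈ s, y z * a z i - ∑ z ∈ s, a z i * ∑ j, c j * a z j := by
        rw [← Finset.sum_sub_distrib]
        exact Finset.sum_congr rfl fun z _ => by ring
    _ = 0 := by rw [h5, sub_self]

/-- Pythagoras: the residual at `c` is orthogonal to every combination of the regressors, in
particular to the difference of the two fits. -/
theorem residualSumSq_le_of_normal_equations {ι n : Type*} [Fintype n] (s : Finset ι)
    (a : ι → n → ℝ) (y : ι → ℝ) (c : n → ℝ)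
    (hc : ∀ i, ∑ z ∈ s, (y z - ∑ j, c j * a z j) * a z i = 0) (c' : n → ℝ) :
    residualSumSq s a y c ≤ residualSumSq s a y c' := by
  have hcross : ∑ z ∈ s, (y z - ∑ j, c j * a z j) * ∑ i, (c i - c' i) * a z i = 0 := by
    simp only [Finset.mul_sum]
    rw [Finset.sum_comm]
    refine Finset.sum_eq_zero fun i _ => ?_
    calc _ = (c i - c' i) * ∑ z ∈ s, (y z - ∑ j, c j * a z j) * a z i := by
          rw [Finset.mul_sum]
          exact Finset.sum_congr rfl fun z _ => by ring
      _ = 0 := by rw [hc, mul_zero]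
  have hsplit : residualSumSq s a y c' = residualSumSq s a y c +
      2 * (∑ z ∈ s, (y z - ∑ j, c j * a z j) * ∑ i, (c i - c' i) * a z i) +
      ∑ z ∈ s, (∑ i, (c i - c' i) * a z i) ^ 2 := by
    simp only [residualSumSq]
    rw [Finset.mul_sum, ← Finset.sum_add_distrib, ← Finset.sum_add_distrib]
    refine Finset.sum_congr rfl fun z _ => ?_
    simp only [sub_mul, Finset.sum_sub_distrib]
    ring
  rw [hsplit, hcross]
  have : 0 ≤ ∑ z ∈ s, (∑ i, (c i - c' i) * a z i) ^ 2 := Finset.sum_nonneg fun z _ => sq_nonneg _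
  linarith

/-- The minimal residual sum of squares is measurable, whatever the choice of the minimizer. -/
theorem measurable_residualSumSq_of_forall_le {Ω ι n : Type*} [MeasurableSpace Ω] [Fintype n]
    (s : Finset ι) {a : Ω → ι → n → ℝ} {y : Ω → ι → ℝ} (c : Ω → n → ℝ)
    (ha : ∀ z i, Measurable fun ω => a ω z i) (hy : ∀ z, Measurable fun ω => y ω z)
    (hc : ∀ ω c', residualSumSq s (a ω) (y ω) (c ω) ≤ residualSumSq s (a ω) (y ω) c') :
    Measurable fun ω => residualSumSq s (a ω) (y ω) (c ω) := by
  refine Measurable.isGLB (f := fun (q : ℕ) ω => residualSumSq s (a ω) (y ω)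
    (TopologicalSpace.denseSeq (n → ℝ) q)) (fun q => ?_) (fun ω => ⟨?_, ?_⟩)
  · unfold residualSumSq
    fun_prop
  · rintro _ ⟨q, rfl⟩
    exact hc ω _
  · intro b hb
    -- A lower bound on the dense sequence extends by continuity to all coefficients, including the
    -- possibly nonmeasurable minimizer `c ω`.
    have hcl : IsClosed {c' : n → ℝ | b ≤ residualSumSq s (a ω) (y ω) c'} := by
      refine isClosed_le continuous_const ?_
      unfold residualSumSq
      fun_prop
    have huniv : {c' : n → ℝ | b ≤ residualSumSq s (a ω) (y ω) c'} = Set.univ := by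
      refine hcl.closure_eq.symm.trans (Set.eq_univ_of_univ_subset ?_)
      rw [← (TopologicalSpace.denseRange_denseSeq (n → ℝ)).closure_range]
      refine closure_mono ?_
      rintro _ ⟨q, rfl⟩
      exact hb ⟨q, rfl⟩
    have : c ω ∈ {c' : n → ℝ | b ≤ residualSumSq s (a ω) (y ω) c'} := huniv ▸ Set.mem_univ _
    exact this

/-! ### Convergence of the Euler scheme along a path -/

/-- Explicit Euler scheme with step `h` for the drift `f` and noise increments `ξ`. -/
def eulerScheme {E : Type*} [AddCommGroup E] [Module ℝ E] (f : E → E) (h : ℝ) (x : E)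
    (ξ : ℕ → E) : ℕ → E
  | 0 => x
  | k + 1 => eulerScheme f h x ξ k + h • f (eulerScheme f h x ξ k) + ξ k

/-- Discrete Gronwall inequality with a confinement argument. The Lipschitz bound is available only
on a ball with margin 1 around the path; `hle` makes the inductive error bound at most 1, which
keeps the scheme in that ball for the next step. -/
theorem norm_eulerScheme_sub_le {E : Type*} [NormedAddCommGroup E] [NormedSpace ℝ E]
    {f : E → E} {K : ℝ≥0} {R : ℝ} (hf : LipschitzOnWith K f (Metric.closedBall 0 (R + 1)))
    {h ε : ℝ} (hh : 0 ≤ h) (hε : 0 ≤ ε) {n : ℕ} (hle : n * h * ε * (1 + K * h) ^ n ≤ 1)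
    {x ξ : ℕ → E} (hx : ∀ k ≤ n, ‖x k‖ ≤ R)
    (hloc : ∀ k < n, ‖x (k + 1) - x k - h • f (x k) - ξ k‖ ≤ h * ε) :
    ∀ k ≤ n, ‖eulerScheme f h (x 0) ξ k - x k‖ ≤ k * h * ε * (1 + K * h) ^ k := by
  intro k
  induction k with
  | zero => intro _; simp [eulerScheme]
  | succ k ih =>
    intro hk
    have ih := ih (by omega)
    have hKh : (1 : ℝ) ≤ 1 + K * h := by nlinarith [K.coe_nonneg, mul_nonneg K.coe_nonneg hh]
    have hle1 : ‖eulerScheme f h (x 0) ξ k - x k‖ ≤ 1 := by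
      refine ih.trans (le_trans ?_ hle)
      have hkn : (k : ℝ) ≤ n := by exact_mod_cast (by omega : k ≤ n)
      gcongr
      omega
    have hxk := hx k (by omega)
    have hmem : eulerScheme f h (x 0) ξ k ∈ Metric.closedBall (0 : E) (R + 1) := by
      rw [mem_closedBall_zero_iff]
      calc ‖eulerScheme f h (x 0) ξ k‖ = ‖(eulerScheme f h (x 0) ξ k - x k) + x k‖ := by
            rw [sub_add_cancel]
        _ ≤ 1 + R := (norm_add_le _ _).trans (add_le_add hle1 hxk)
        _ = R + 1 := add_comm _ _
    have hmem' : x k ∈ Metric.closedBall (0 : E) (R + 1) := by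
      rw [mem_closedBall_zero_iff]; linarith
    have hlip : ‖f (eulerScheme f h (x 0) ξ k) - f (x k)‖ ≤
        K * ‖eulerScheme f h (x 0) ξ k - x k‖ := by
      simpa [dist_eq_norm] using hf.dist_le_mul _ hmem _ hmem'
    have hdecomp : eulerScheme f h (x 0) ξ (k + 1) - x (k + 1) =
        (eulerScheme f h (x 0) ξ k - x k) +
        h • (f (eulerScheme f h (x 0) ξ k) - f (x k)) -
        (x (k + 1) - x k - h • f (x k) - ξ k) := by
      simp only [eulerScheme, smul_sub]
      abel
    set e := ‖eulerScheme f h (x 0) ξ k - x k‖ with he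
    calc ‖eulerScheme f h (x 0) ξ (k + 1) - x (k + 1)‖
        ≤ e + h * (K * e) + h * ε := by
          rw [hdecomp]
          refine (norm_sub_le _ _).trans (add_le_add ((norm_add_le _ _).trans ?_) (hloc k hk))
          rw [norm_smul, Real.norm_of_nonneg hh]
          gcongr
      _ = e * (1 + K * h) + h * ε := by ring
      _ ≤ k * h * ε * (1 + K * h) ^ k * (1 + K * h) + h * ε * (1 + K * h) ^ (k + 1) := by
          have h1 : (1 : ℝ) ≤ (1 + K * h) ^ (k + 1) := one_le_pow₀ hKh
          have h2 : h * ε ≤ h * ε * (1 + K * h) ^ (k + 1) :=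
            le_mul_of_one_le_right (mul_nonneg hh hε) h1
          have h3 := mul_le_mul_of_nonneg_right ih (zero_le_one.trans hKh)
          linarith
      _ = (k + 1 : ℕ) * h * ε * (1 + K * h) ^ (k + 1) := by push_cast; ring

/-- If `x` solves `x(t) - x(s) = ∫ₛᵗ f(x) + w(t) - w(s)` on `[a, a + T]` then the Euler schemes
with step `T / n` started at `x(a)` converge to `x(a + T)`. -/
theorem tendsto_eulerScheme {E : Type*} [NormedAddCommGroup E] [NormedSpace ℝ E]
    [ProperSpace E] {f : E → E} (hf : LocallyLipschitz f) {x w : ℝ → E}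
    (hx : Continuous x) {a T : ℝ} (hT : 0 < T)
    (heq : ∀ s t, a ≤ s → s ≤ t → t ≤ a + T → x t - x s = (∫ u in s..t, f (x u)) + (w t - w s)) :
    Tendsto (fun n : ℕ => eulerScheme f (T / n) (x a)
      (fun k => w (a + (k + 1 : ℕ) * (T / n)) - w (a + k * (T / n))) n) atTop
      (𝓝 (x (a + T))) := by
  have hfx : Continuous fun t => f (x t) := hf.continuous.comp hx
  obtain ⟨R, hR⟩ : ∃ R, ∀ t ∈ Set.Icc a (a + T), ‖x t‖ ≤ R :=
    isCompact_Icc.exists_bound_of_continuousOn hx.continuousOn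
  obtain ⟨K, hK⟩ := LocallyLipschitzOn.exists_lipschitzOnWith_of_compact
    (isCompact_closedBall (0 : E) (R + 1)) (hf.locallyLipschitzOn (s := _))
  have huc : UniformContinuousOn (fun t => f (x t)) (Set.Icc a (a + T)) :=
    isCompact_Icc.uniformContinuousOn_of_continuous hfx.continuousOn
  rw [Metric.tendsto_atTop]
  intro ε₀ hε₀
  -- `D` is the Gronwall factor from local to global error. `ε` is chosen so that `D * ε` is at most
  -- 1, as confinement in the ball requires, and at most `ε₀ / 2`, the target accuracy.
  set D : ℝ := T * Real.exp (K * T) with hD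
  have hDpos : 0 < D := mul_pos hT (Real.exp_pos _)
  set ε : ℝ := min 1 (ε₀ / 2) / D with hε
  have hεpos : 0 < ε := div_pos (lt_min one_pos (by linarith)) hDpos
  have hDε : D * ε = min 1 (ε₀ / 2) := by rw [hε]; field_simp
  obtain ⟨η, hη, hηuc⟩ := Metric.uniformContinuousOn_iff.1 huc ε hεpos
  obtain ⟨n₀, hn₀⟩ := exists_nat_gt (T / η)
  -- The extra 1 excludes `n = 0`, where the step `T / n` would be 0 by convention.
  refine ⟨n₀ + 1, fun n hn => ?_⟩
  have hnpos : (0 : ℝ) < n := by exact_mod_cast (by omega : 0 < n)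
  set h : ℝ := T / n with hh
  have hhpos : 0 < h := div_pos hT hnpos
  have hnh : n * h = T := by rw [hh]; field_simp
  have hhη : h < η := by
    have h1 : T / η < n := hn₀.trans_le (by exact_mod_cast (by omega : n₀ ≤ n))
    rw [hh, div_lt_iff₀ hnpos]
    rw [div_lt_iff₀ hη] at h1
    linarith
  have hgrid : ∀ k ≤ n, a + k * h ∈ Set.Icc a (a + T) := by
    intro k hk
    have hk' : (k : ℝ) ≤ n := by exact_mod_cast hk
    constructor
    · have : 0 ≤ k * h := by positivity
      linarith
    · have : k * h ≤ n * h := by gcongr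
      linarith
  have hpow : (1 + K * h) ^ n ≤ Real.exp (K * T) := by
    calc (1 + K * h) ^ n ≤ (Real.exp (K * h)) ^ n := by
          gcongr
          linarith [Real.add_one_le_exp (K * h)]
      _ = Real.exp (K * T) := by rw [← Real.exp_nat_mul, ← hnh]; congr 1; ring
  have hbound : n * h * ε * (1 + K * h) ^ n ≤ min 1 (ε₀ / 2) := by
    rw [hnh, ← hDε, hD]
    calc T * ε * (1 + K * h) ^ n ≤ T * ε * Real.exp (K * T) := by gcongr
      _ = T * Real.exp (K * T) * ε := by ring
  have hloc : ∀ k < n, ‖x (a + (k + 1 : ℕ) * h) - x (a + k * h) - h • f (x (a + k * h)) -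
      (w (a + (k + 1 : ℕ) * h) - w (a + k * h))‖ ≤ h * ε := by
    intro k hk
    have h1 := hgrid k hk.le
    have h2 := hgrid (k + 1) hk
    have h3 : a + k * h ≤ a + (k + 1 : ℕ) * h := by push_cast; nlinarith
    have h4 : a + (k + 1 : ℕ) * h - (a + k * h) = h := by push_cast; ring
    rw [heq _ _ h1.1 h3 h2.2]
    have h5 : h • f (x (a + k * h)) =
        ∫ _ in (a + k * h)..(a + (k + 1 : ℕ) * h), f (x (a + k * h)) := by
      rw [intervalIntegral.integral_const, h4]
    -- The noise increments cancel exactly, so the local error only sees the oscillation of `f ∘ x`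
    -- over one step; no regularity of `w` is involved.
    have h6 : (∫ u in (a + k * h)..(a + (k + 1 : ℕ) * h), f (x u)) +
        (w (a + (k + 1 : ℕ) * h) - w (a + k * h)) - h • f (x (a + k * h)) -
        (w (a + (k + 1 : ℕ) * h) - w (a + k * h)) =
        ∫ u in (a + k * h)..(a + (k + 1 : ℕ) * h), (f (x u) - f (x (a + k * h))) := by
      rw [intervalIntegral.integral_sub (hfx.intervalIntegrable _ _)
        (intervalIntegrable_const), ← h5]
      abel
    rw [h6]
    have h7 : ‖∫ u in (a + k * h)..(a + (k + 1 : ℕ) * h), (f (x u) - f (x (a + k * h)))‖ ≤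
        ε * |a + (k + 1 : ℕ) * h - (a + k * h)| := by
      refine intervalIntegral.norm_integral_le_of_norm_le_const fun u hu => ?_
      rw [Set.uIoc_of_le h3] at hu
      have := hηuc u ⟨h1.1.trans hu.1.le, hu.2.trans h2.2⟩ _ h1 (by
        rw [Real.dist_eq, abs_of_nonneg (by linarith [hu.1])]
        linarith [hu.2])
      rw [← dist_eq_norm]
      exact this.le
    rwa [h4, abs_of_pos hhpos, mul_comm ε h] at h7
  have hmain := norm_eulerScheme_sub_le (x := fun k : ℕ => x (a + k * h))
    (ξ := fun k : ℕ => w (a + (k + 1 : ℕ) * h) - w (a + k * h)) hK hhpos.le hεpos.le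
    (hbound.trans (min_le_left _ _)) (fun k hk => hR _ (hgrid k hk)) hloc n le_rfl
  have hend : a + n * h = a + T := by rw [hnh]
  simp only [Nat.cast_zero, zero_mul, add_zero] at hmain
  rw [hend] at hmain
  rw [dist_eq_norm]
  calc _ ≤ _ := hmain
    _ ≤ min 1 (ε₀ / 2) := hbound
    _ ≤ ε₀ / 2 := min_le_right _ _
    _ < ε₀ := by linarith

/-! ### The joint law of a one-step transition and the driving noise -/

theorem continuous_noiseTerm {d m : ℕ} (σ : Matrix (Fin d) (Fin m) ℝ) :
    Continuous (noiseTerm σ) := by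
  unfold noiseTerm
  fun_prop

theorem noiseTerm_sub {d m : ℕ} (σ : Matrix (Fin d) (Fin m) ℝ)
    (ξ η : EuclideanSpace ℝ (Fin m)) :
    noiseTerm σ (ξ - η) = noiseTerm σ ξ - noiseTerm σ η := by
  simp [noiseTerm, Matrix.mulVec_sub]

/-- The law of the increments of an `m`-dimensional Brownian motion over a time `h`. -/
noncomputable def brownianIncrementLaw (m : ℕ) (h : ℝ≥0) : Measure (EuclideanSpace ℝ (Fin m)) :=
  (Measure.pi fun _ : Fin m => gaussianReal 0 h).map (WithLp.toLp 2)

section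

variable {Ω : Type*} [mΩ : MeasurableSpace Ω] {d m : ℕ} {P : Measure Ω}
  {ℱ : Filtration ℝ≥0 mΩ} {B : ℝ≥0 → Ω → EuclideanSpace ℝ (Fin m)}

theorem IsFilteredBrownian.measurable (hB : IsFilteredBrownian P ℱ B) (t : ℝ≥0) :
    Measurable (B t) :=
  (hB.adapted t).mono (ℱ.le t) le_rfl

theorem IsFilteredBrownian.map_increment [IsProbabilityMeasure P]
    (hB : IsFilteredBrownian P ℱ B) (s h : ℝ≥0) :
    P.map (fun ω => B (s + h) ω - B s ω) = brownianIncrementLaw m h := by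
  have hmeas : ∀ k, Measurable fun ω => B (s + h) ω k - B s ω k := fun k => by
    have h1 := hB.measurable (s + h)
    have h2 := hB.measurable s
    fun_prop
  have hind : iIndepFun (fun (k : Fin m) ω => B (s + h) ω k - B s ω k) P :=
    hB.indep_coord.comp (fun _ (g : ℝ≥0 → ℝ) => g (s + h) - g s)
      fun _ => (measurable_pi_apply _).sub (measurable_pi_apply _)
  have hlaw : ∀ k, P.map (fun ω => B (s + h) ω k - B s ω k) = gaussianReal 0 h := fun k => by
    have h1 := ((hB.isBrownianReal_coord k).toIsPreBrownianReal.hasLaw_sub (s + h) s).map_eq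
    have h2 : nndist ((s + h : ℝ≥0) : ℝ) (s : ℝ) = h := by
      ext
      simp
    exact h1.trans (congrArg _ h2)
  have hpi := (iIndepFun_iff_map_fun_eq_pi_map fun k => (hmeas k).aemeasurable).1 hind
  simp only [hlaw] at hpi
  rw [brownianIncrementLaw, ← hpi, Measure.map_map (by fun_prop) (measurable_pi_lambda _ hmeas)]
  rfl

instance (m : ℕ) (h : ℝ≥0) : IsProbabilityMeasure (brownianIncrementLaw m h) :=
  Measure.isProbabilityMeasure_map (by fun_prop)

variable {f : EuclideanSpace ℝ (Fin d) → EuclideanSpace ℝ (Fin d)}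
  {σ : Matrix (Fin d) (Fin m) ℝ} {X : ℝ≥0 → Ω → EuclideanSpace ℝ (Fin d)}

/-- Starting point, position after `k` Euler steps of length `h`, and accumulated noise, for the
scheme started from the process `X` at time `a`. -/
noncomputable def eulerChain (f : EuclideanSpace ℝ (Fin d) → EuclideanSpace ℝ (Fin d))
    (σ : Matrix (Fin d) (Fin m) ℝ) (B : ℝ≥0 → Ω → EuclideanSpace ℝ (Fin m))
    (X : ℝ≥0 → Ω → EuclideanSpace ℝ (Fin d)) (a h : ℝ≥0) (k : ℕ) (ω : Ω) :
    EuclideanSpace ℝ (Fin d) × EuclideanSpace ℝ (Fin d) × EuclideanSpace ℝ (Fin m) :=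
  (X a ω, eulerScheme f h (X a ω)
    (fun j => noiseTerm σ (B (a + (j + 1 : ℕ) * h) ω) - noiseTerm σ (B (a + j * h) ω)) k,
    B (a + k * h) ω - B a ω)

/-- One transition of `eulerChain`, as a function of the state and of the noise increment. -/
noncomputable def eulerTransition (f : EuclideanSpace ℝ (Fin d) → EuclideanSpace ℝ (Fin d))
    (σ : Matrix (Fin d) (Fin m) ℝ) (h : ℝ≥0)
    (z : (EuclideanSpace ℝ (Fin d) × EuclideanSpace ℝ (Fin d) × EuclideanSpace ℝ (Fin m)) ×
      EuclideanSpace ℝ (Fin m)) :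
    EuclideanSpace ℝ (Fin d) × EuclideanSpace ℝ (Fin d) × EuclideanSpace ℝ (Fin m) :=
  (z.1.1, z.1.2.1 + (h : ℝ) • f z.1.2.1 + noiseTerm σ z.2, z.1.2.2 + z.2)

theorem measurable_eulerTransition (hf : Continuous f) (h : ℝ≥0) :
    Measurable (eulerTransition f σ h) := by
  have := continuous_noiseTerm σ
  unfold eulerTransition
  exact Continuous.measurable (by fun_prop)

theorem eulerChain_succ {Ω : Type*} {B : ℝ≥0 → Ω → EuclideanSpace ℝ (Fin m)}
    {X : ℝ≥0 → Ω → EuclideanSpace ℝ (Fin d)} (a h : ℝ≥0) (k : ℕ) (ω : Ω) :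
    eulerChain f σ B X a h (k + 1) ω = eulerTransition f σ h
      (eulerChain f σ B X a h k ω, B (a + k * h + h) ω - B (a + k * h) ω) := by
  have h1 : a + (k + 1 : ℕ) * h = a + k * h + h := by push_cast; ring
  simp only [eulerChain, eulerTransition, eulerScheme, h1, noiseTerm_sub]
  simp

/-- Measurability with respect to the past at time `a + k * h`, and not merely on Ω, is what makes
the chain independent of the next noise increment. -/
theorem measurable_eulerChain (hX : IsSDESolution f σ P ℱ B X) (hf : Continuous f)
    (a h : ℝ≥0) (k : ℕ) : Measurable[ℱ (a + k * h)] (eulerChain f σ B X a h k) := by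
  have hB : ∀ s ≤ a + k * h, Measurable[ℱ (a + k * h)] (B s) := fun s hs =>
    (hX.brownian.adapted s).mono (ℱ.mono hs) le_rfl
  induction k with
  | zero =>
    have h1 : Measurable[ℱ (a + (0 : ℕ) * h)] (X a) :=
      (hX.adapted a).mono (ℱ.mono (by simp)) le_rfl
    have h2 := hB a (by simp)
    have h3 := hB (a + (0 : ℕ) * h) le_rfl
    exact h1.prodMk (h1.prodMk (h3.sub h2))
  | succ k ih =>
    have hle : a + k * h ≤ a + (k + 1 : ℕ) * h := by gcongr; simp
    have h1 : a + k * h + h = a + (k + 1 : ℕ) * h := by push_cast; ring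
    have h2 := (ih fun s hs => (hX.brownian.adapted s).mono (ℱ.mono hs) le_rfl).mono
      (ℱ.mono hle) le_rfl
    have h3 := hB (a + k * h + h) h1.le
    have h4 := hB (a + k * h) hle
    rw [funext (eulerChain_succ a h k)]
    exact (measurable_eulerTransition hf h).comp (h2.prodMk (h3.sub h4))

/-- Markov property: the next noise increment is independent of the past and has a law depending
only on `h`. The kernel therefore retains no trace of the trajectory or of the starting time. -/
theorem map_eulerChain_succ [IsProbabilityMeasure P]
    (hX : IsSDESolution f σ P ℱ B X) (hf : Continuous f)
    (a h : ℝ≥0) (k : ℕ) :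
    P.map (eulerChain f σ B X a h (k + 1)) =
      ((P.map (eulerChain f σ B X a h k)).prod (brownianIncrementLaw m h)).map
        (eulerTransition f σ h) := by
  have hZ := measurable_eulerChain hX hf a h k
  have hZ' : Measurable (eulerChain f σ B X a h k) := hZ.mono (ℱ.le _) le_rfl
  have hD : Measurable fun ω => B (a + k * h + h) ω - B (a + k * h) ω :=
    (hX.brownian.measurable _).sub (hX.brownian.measurable _)
  have hind : IndepFun (eulerChain f σ B X a h k)
      (fun ω => B (a + k * h + h) ω - B (a + k * h) ω) P := by
    rw [IndepFun_iff_Indep]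
    exact indep_of_indep_of_le_left
      (hX.brownian.indep_increment (a + k * h) (a + k * h + h) le_self_add).symm hZ.comap_le
  rw [← hX.brownian.map_increment (a + k * h) h,
    ← (indepFun_iff_map_prod_eq_prod_map_map hZ'.aemeasurable hD.aemeasurable).1 hind,
    Measure.map_map (measurable_eulerTransition hf h) (hZ'.prodMk hD),
    funext (eulerChain_succ a h k)]
  rfl

theorem map_eulerChain_eq [IsProbabilityMeasure P] {ℱ' : Filtration ℝ≥0 mΩ}
    {B' : ℝ≥0 → Ω → EuclideanSpace ℝ (Fin m)}
    {X' : ℝ≥0 → Ω → EuclideanSpace ℝ (Fin d)} (hX : IsSDESolution f σ P ℱ B X)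
    (hX' : IsSDESolution f σ P ℱ' B' X') (hf : Continuous f) {a a' : ℝ≥0}
    (hlaw : P.map (X a) = P.map (X' a')) (h : ℝ≥0) (k : ℕ) :
    P.map (eulerChain f σ B X a h k) = P.map (eulerChain f σ B' X' a' h k) := by
  induction k with
  | zero =>
    -- At step 0 the chain is a fixed function of the starting point, with no accumulated noise.
    have key : ∀ (ℱ : Filtration ℝ≥0 mΩ) (B : ℝ≥0 → Ω → EuclideanSpace ℝ (Fin m))
        (X : ℝ≥0 → Ω → EuclideanSpace ℝ (Fin d)) (a : ℝ≥0), IsSDESolution f σ P ℱ B X →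
        P.map (eulerChain f σ B X a h 0) =
          (P.map (X a)).map fun x => (x, x, (0 : EuclideanSpace ℝ (Fin m))) := by
      intro ℱ B X a hX
      rw [Measure.map_map (by fun_prop) ((hX.adapted a).mono (ℱ.le a) le_rfl)]
      congr 1
      ext ω : 1
      simp [eulerChain, eulerScheme]
    rw [key ℱ B X a hX, key ℱ' B' X' a' hX', hlaw]
  | succ k ih => rw [map_eulerChain_succ hX hf, map_eulerChain_succ hX' hf, ih]

theorem tendsto_eulerChain (hX : IsSDESolution f σ P ℱ B X) (hf : LocallyLipschitz f)
    (a : ℝ≥0) {δ : ℝ≥0} (hδ : 0 < δ) :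
    ∀ᵐ ω ∂P, Tendsto (fun n : ℕ => eulerChain f σ B X a (δ / n) n ω) atTop
      (𝓝 (X a ω, X (a + δ) ω, B (a + δ) ω - B a ω)) := by
  filter_upwards [hX.continuous_paths, hX.integral_eq] with ω hc hi
  have hcx : Continuous fun t : ℝ => X t.toNNReal ω := hc.comp continuous_real_toNNReal
  have hfx : Continuous fun t : ℝ => f (X t.toNNReal ω) := hf.continuous.comp hcx
  have hE := tendsto_eulerScheme hf (x := fun t => X t.toNNReal ω)
    (w := fun t => noiseTerm σ (B t.toNNReal ω)) hcx (a := a) (T := δ) (by exact_mod_cast hδ)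
    (by
      intro s t has hst _
      have hs : 0 ≤ s := a.coe_nonneg.trans has
      have h1 := hi s.toNNReal
      have h2 := hi t.toNNReal
      rw [Real.coe_toNNReal _ hs] at h1
      rw [Real.coe_toNNReal _ (hs.trans hst)] at h2
      rw [← intervalIntegral.integral_interval_sub_left (hfx.intervalIntegrable 0 t)
        (hfx.intervalIntegrable 0 s)]
      rw [h1, h2]
      abel)
  have hgrid : ∀ (n : ℕ) (k : ℕ), ((a : ℝ) + (k : ℝ) * ((δ : ℝ) / n)).toNNReal =
      a + k * (δ / n) := fun n k => by
    rw [← Real.toNNReal_coe (r := a + k * (δ / n))]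
    push_cast
    rfl
  have hend : ((a : ℝ) + δ).toNNReal = a + δ := by
    rw [← NNReal.coe_add, Real.toNNReal_coe]
  simp only [hgrid, Real.toNNReal_coe, hend] at hE
  refine tendsto_const_nhds.prodMk_nhds (Tendsto.prodMk_nhds ?_ ?_)
  · refine hE.congr fun n => ?_
    simp
  -- The accumulated noise is constant in `n` as soon as `n ≠ 0`, since then `n * (δ / n) = δ`.
  · refine tendsto_const_nhds.congr' ?_
    filter_upwards [eventually_gt_atTop 0] with n hn
    have hn' : (n : ℝ≥0) ≠ 0 := by exact_mod_cast hn.ne'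
    rw [mul_div_cancel₀ _ hn']

/-- Almost sure convergence implies convergence of integrals of bounded continuous functions, by
dominated convergence, and these integrals determine a finite measure. -/
theorem map_eq_of_tendsto_ae [IsProbabilityMeasure P]
    {E : Type*} [TopologicalSpace E] [MeasurableSpace E]
    [BorelSpace E] [HasOuterApproxClosed E] {U V : ℕ → Ω → E} {u v : Ω → E}
    (hU : ∀ n, AEMeasurable (U n) P) (hV : ∀ n, AEMeasurable (V n) P)
    (hu : AEMeasurable u P) (hv : AEMeasurable v P) (hmap : ∀ n, P.map (U n) = P.map (V n))
    (hUu : ∀ᵐ ω ∂P, Tendsto (fun n => U n ω) atTop (𝓝 (u ω)))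
    (hVv : ∀ᵐ ω ∂P, Tendsto (fun n => V n ω) atTop (𝓝 (v ω))) :
    P.map u = P.map v := by
  have := Measure.isProbabilityMeasure_map hu
  have := Measure.isProbabilityMeasure_map hv
  refine ext_of_forall_integral_eq_of_IsFiniteMeasure fun g => ?_
  have hg : Measurable g := g.continuous.measurable
  have key : ∀ {W : ℕ → Ω → E} {w : Ω → E}, (∀ n, AEMeasurable (W n) P) → AEMeasurable w P →
      (∀ᵐ ω ∂P, Tendsto (fun n => W n ω) atTop (𝓝 (w ω))) →
      Tendsto (fun n => ∫ x, g x ∂P.map (W n)) atTop (𝓝 (∫ x, g x ∂P.map w)) := by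
    intro W w hW hw hlim
    have hI : ∀ {z : Ω → E}, AEMeasurable z P → ∫ x, g x ∂P.map z = ∫ ω, g (z ω) ∂P :=
      fun hz => integral_map hz hg.aestronglyMeasurable
    rw [hI hw]
    simp only [fun n => hI (hW n)]
    refine tendsto_integral_of_dominated_convergence (fun _ => ‖g‖)
      (fun n => (hg.comp_aemeasurable (hW n)).aestronglyMeasurable) (integrable_const _)
      (fun n => Eventually.of_forall fun ω => g.norm_coe_le_norm _) ?_
    filter_upwards [hlim] with ω hω
    exact (g.continuous.tendsto _).comp hω
  have h1 := key hU hu hUu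
  simp only [hmap] at h1
  exact tendsto_nhds_unique h1 (key hV hv hVv)

/-- The joint law of the endpoints of a transition of duration `δ` and of the noise increment is
determined by the law of the starting point. -/
theorem map_transition_eq [IsProbabilityMeasure P] {ℱ' : Filtration ℝ≥0 mΩ}
    {B' : ℝ≥0 → Ω → EuclideanSpace ℝ (Fin m)}
    {X' : ℝ≥0 → Ω → EuclideanSpace ℝ (Fin d)} (hX : IsSDESolution f σ P ℱ B X)
    (hX' : IsSDESolution f σ P ℱ' B' X') (hf : LocallyLipschitz f) {a a' : ℝ≥0}
    (hlaw : P.map (X a) = P.map (X' a')) {δ : ℝ≥0} (hδ : 0 < δ) :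
    P.map (fun ω => (X a ω, X (a + δ) ω, B (a + δ) ω - B a ω)) =
      P.map (fun ω => (X' a' ω, X' (a' + δ) ω, B' (a' + δ) ω - B' a' ω)) := by
  have hmX : ∀ t, Measurable (X t) := fun t => (hX.adapted t).mono (ℱ.le t) le_rfl
  have hmX' : ∀ t, Measurable (X' t) := fun t => (hX'.adapted t).mono (ℱ'.le t) le_rfl
  exact map_eq_of_tendsto_ae
    (fun n => ((measurable_eulerChain hX hf.continuous a (δ / n) n).mono
      (ℱ.le _) le_rfl).aemeasurable)
    (fun n => ((measurable_eulerChain hX' hf.continuous a' (δ / n) n).mono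
      (ℱ'.le _) le_rfl).aemeasurable)
    ((hmX _).prodMk ((hmX _).prodMk
      ((hX.brownian.measurable _).sub (hX.brownian.measurable _)))).aemeasurable
    ((hmX' _).prodMk ((hmX' _).prodMk
      ((hX'.brownian.measurable _).sub (hX'.brownian.measurable _)))).aemeasurable
    (fun n => map_eulerChain_eq hX hX' hf.continuous hlaw (δ / n) n)
    (tendsto_eulerChain hX hf a hδ) (tendsto_eulerChain hX' hf a' hδ)

end

/-! ### The parametric forms of the Euler-Maruyama and Runge-Kutta schemes -/

theorem parametrizes_emBasis {d m : ℕ}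
    {f : EuclideanSpace ℝ (Fin d) → EuclideanSpace ℝ (Fin d)} (hf : Continuous f)
    (σ : Matrix (Fin d) (Fin m) ℝ) : Parametrizes (emBasis f σ) (emFlow f σ) := by
  have hσ := continuous_noiseTerm σ
  -- The state `x` gets weight 0; the other two basis functions are the two terms of the flow map.
  refine fun δ _ => ⟨fun i => ?_, fun i _ => ![0, 1, 1] i, fun x ξ => ?_⟩
  · fin_cases i <;> refine Continuous.measurable ?_ <;> simp only [emBasis] <;>
      simp <;> fun_prop
  · ext k
    simp [emFlow, parametricFlow, emBasis, Fin.sum_univ_three]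

theorem measurable_rk4Increment {d m : ℕ}
    {f : EuclideanSpace ℝ (Fin d) → EuclideanSpace ℝ (Fin d)} (hf : Continuous f)
    (σ : Matrix (Fin d) (Fin m) ℝ) (δ : ℝ≥0) :
    Measurable fun z : EuclideanSpace ℝ (Fin d) × EuclideanSpace ℝ (Fin m) =>
      rk4Increment f σ δ z.1 z.2 := by
  have hσ := continuous_noiseTerm σ
  refine Continuous.measurable ?_
  unfold rk4Increment
  fun_prop

theorem measurable_rk4Basis {d m : ℕ}
    {f : EuclideanSpace ℝ (Fin d) → EuclideanSpace ℝ (Fin d)} (hf : Continuous f)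
    (σ : Matrix (Fin d) (Fin m) ℝ) (δ : ℝ≥0) (i : Fin (2 + 1)) :
    Measurable fun z : EuclideanSpace ℝ (Fin d) × EuclideanSpace ℝ (Fin m) =>
      rk4Basis f σ i δ z.1 z.2 := by
  have hσ := (continuous_noiseTerm σ).measurable
  have hrk := measurable_rk4Increment hf σ δ
  fin_cases i
  · exact measurable_fst
  · exact hrk
  · exact (hσ.comp measurable_snd).const_smul (δ : ℝ)⁻¹

theorem parametrizes_rk4Basis {d m : ℕ}
    {f : EuclideanSpace ℝ (Fin d) → EuclideanSpace ℝ (Fin d)} (hf : Continuous f)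
    (σ : Matrix (Fin d) (Fin m) ℝ) : Parametrizes (rk4Basis f σ) (rk4Increment f σ) := by
  -- The Runge-Kutta increment already contains the stochastic force, whose separate coefficient is
  -- therefore 0.
  refine fun δ _ => ⟨measurable_rk4Basis hf σ δ, fun i _ => ![0, 1, 0] i, fun x ξ => ?_⟩
  ext k
  simp [parametricFlow, rk4Basis, Fin.sum_univ_three]

theorem parametrizes_rk4Basis_addNoise {d m : ℕ}
    {f : EuclideanSpace ℝ (Fin d) → EuclideanSpace ℝ (Fin d)} (hf : Continuous f)
    (σ : Matrix (Fin d) (Fin m) ℝ) : Parametrizes (rk4Basis f σ) (rk4AddNoiseFlow f σ) := by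
  refine fun δ _ => ⟨measurable_rk4Basis hf σ δ, fun i _ => ![0, 1, 1] i, fun x ξ => ?_⟩
  ext k
  simp [rk4AddNoiseFlow, parametricFlow, rk4Basis, Fin.sum_univ_three]

theorem Parametrizes.measurable {d m p : ℕ} {φ : Fin (p + 1) → FlowMap d m} {F : FlowMap d m}
    (h : Parametrizes φ F) {δ : ℝ≥0} (hδ : 0 < δ) :
    Measurable fun z : EuclideanSpace ℝ (Fin d) × EuclideanSpace ℝ (Fin m) =>
      F δ z.1 z.2 := by
  obtain ⟨hφ, c, hc⟩ := h δ hδ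
  simp only [hc, parametricFlow]
  refine (PiLp.continuous_toLp 2 _).measurable.comp (measurable_pi_lambda _ fun k => ?_)
  refine Finset.measurable_sum _ fun i _ => Measurable.const_mul ?_ _
  have := hφ i
  fun_prop

/-! ### The residual variances as residual sums of squares -/

section Residual

variable {Ω : Type*} {d m p M : ℕ}

/-- The index set of the observed transitions. -/
def sampleIndex (M N : ℕ) : Finset (Fin M × ℕ) := Finset.univ ×ˢ Finset.range N

/-- The regressors of the `k`-th component. -/
noncomputable def regressor (φ : Fin (p + 1) → FlowMap d m)
    (B : Fin M → ℝ≥0 → Ω → EuclideanSpace ℝ (Fin m))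
    (X : Fin M → ℝ≥0 → Ω → EuclideanSpace ℝ (Fin d)) (δ : ℝ≥0) (k : Fin d) (ω : Ω)
    (z : Fin M × ℕ) (i : Fin (p + 1)) : ℝ :=
  φ i δ (X z.1 (z.2 * δ) ω) (noiseIncrement (B z.1) δ z.2 ω) k

/-- The responses of the `k`-th component. -/
noncomputable def response (X : Fin M → ℝ≥0 → Ω → EuclideanSpace ℝ (Fin d)) (δ : ℝ≥0)
    (k : Fin d) (ω : Ω) (z : Fin M × ℕ) : ℝ :=
  flowIncrement (X z.1) δ z.2 ω k

variable (φ : Fin (p + 1) → FlowMap d m) (B : Fin M → ℝ≥0 → Ω → EuclideanSpace ℝ (Fin m))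
  (X : Fin M → ℝ≥0 → Ω → EuclideanSpace ℝ (Fin d)) {δ : ℝ≥0} {N : ℕ}

/-- The factor `1 / δ ^ 2` moves into the squares, turning residuals of the state into residuals of
a linear regression for the flow increments. -/
theorem residualVarianceCoord_eq (hδ : 0 < δ) (k : Fin d) (ω : Ω) :
    residualVarianceCoord φ B X δ N k ω = 1 / ((M : ℝ) * N) *
      residualSumSq (sampleIndex M N) (regressor φ B X δ k ω) (response X δ k ω)
        (fun i => estimator φ B X δ N ω i k) := by
  have hδ' : (δ : ℝ) ≠ 0 := by exact_mod_cast hδ.ne'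
  rw [residualVarianceCoord, residualSumSq, sampleIndex, Finset.sum_product, mul_comm (1 / _),
    mul_assoc]
  congr 1
  rw [Finset.mul_sum]
  refine Finset.sum_congr rfl fun r _ => ?_
  rw [Finset.mul_sum]
  refine Finset.sum_congr rfl fun n _ => ?_
  simp only [regressor, response, flowIncrement, parametricFlow, PiLp.sub_apply, PiLp.smul_apply,
    smul_eq_mul]
  field_simp

/-- The squared Euclidean norm splits over components, so componentwise least squares also controls
the residual of the whole scheme. -/
theorem residualVariance_eq_sum (ω : Ω) :
    residualVariance φ B X δ N ω =
      ∑ k, 2 / (d : ℝ) * residualVarianceCoord φ B X δ N k ω := by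
  simp only [residualVariance, residualVarianceCoord, EuclideanSpace.real_norm_sq_eq]
  simp only [Finset.mul_sum]
  conv_rhs => rw [Finset.sum_comm]
  refine Finset.sum_congr rfl fun r _ => ?_
  conv_rhs => rw [Finset.sum_comm]
  refine Finset.sum_congr rfl fun n _ => Finset.sum_congr rfl fun k _ => ?_
  rw [mul_comm (d : ℝ), ← one_div_mul_eq_div (_ * _), one_div_mul_eq_div, div_mul_eq_div_div]
  ring

theorem estimator_minimizes (hM : 0 < M) (hN : 0 < N) (k : Fin d) (ω : Ω)
    (c : Fin (p + 1) → ℝ) :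
    residualSumSq (sampleIndex M N) (regressor φ B X δ k ω) (response X δ k ω)
        (fun i => estimator φ B X δ N ω i k) ≤
      residualSumSq (sampleIndex M N) (regressor φ B X δ k ω) (response X δ k ω) c := by
  -- With an empty sample this weight would be 0; only a nonzero weight makes the weighted normal
  -- equations equivalent to the unweighted ones.
  have hw : 1 / ((M : ℝ) * N) ≠ 0 := by positivity
  refine residualSumSq_le_of_normal_equations _ _ _ _ (normal_equations _ _ _ hw _ ?_) c
  have h1 : normalMatrix φ B X δ N k ω = Matrix.of fun i j => 1 / ((M : ℝ) * N) *
      ∑ z ∈ sampleIndex M N, regressor φ B X δ k ω z i * regressor φ B X δ k ω z j := by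
    simp only [sampleIndex, Finset.sum_product]
    rfl
  have h2 : normalVector φ B X δ N k ω = fun i => 1 / ((M : ℝ) * N) *
      ∑ z ∈ sampleIndex M N, response X δ k ω z * regressor φ B X δ k ω z i := by
    simp only [sampleIndex, Finset.sum_product]
    rfl
  rw [← h1, ← h2]
  rfl

theorem enorm_sq_eq_ofReal_sq (x : ℝ) : ‖x‖ₑ ^ 2 = ENNReal.ofReal (x ^ 2) := by
  rw [← ofReal_norm, ← ENNReal.ofReal_pow (norm_nonneg _), Real.norm_eq_abs, sq_abs]

end Residual

/-! ### Expectations of the residual variances -/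

section Sample

variable {Ω : Type u} [mΩ : MeasurableSpace Ω] {d m M : ℕ}
  {f : EuclideanSpace ℝ (Fin d) → EuclideanSpace ℝ (Fin d)} {σ : Matrix (Fin d) (Fin m) ℝ}
  {μ : Measure (EuclideanSpace ℝ (Fin d))} {P : Measure Ω}
  {ℱ : Fin M → Filtration ℝ≥0 mΩ} {B : Fin M → ℝ≥0 → Ω → EuclideanSpace ℝ (Fin m)}
  {X : Fin M → ℝ≥0 → Ω → EuclideanSpace ℝ (Fin d)} {p : ℕ} {φ : Fin (p + 1) → FlowMap d m}
  {F : FlowMap d m} {δ : ℝ≥0} {N : ℕ}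

theorem IsTrajectorySample.measurable_state (h : IsTrajectorySample f σ μ P ℱ B X) (r : Fin M)
    (t : ℝ≥0) : Measurable (X r t) :=
  ((h.solution r).adapted t).mono ((ℱ r).le t) le_rfl

theorem IsTrajectorySample.measurable_noiseIncrement (h : IsTrajectorySample f σ μ P ℱ B X)
    (r : Fin M) (n : ℕ) : Measurable (noiseIncrement (B r) δ n) :=
  ((h.solution r).brownian.measurable _).sub ((h.solution r).brownian.measurable _)

theorem IsTrajectorySample.measurable_flowIncrement (h : IsTrajectorySample f σ μ P ℱ B X)
    (r : Fin M) (n : ℕ) : Measurable (flowIncrement (X r) δ n) :=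
  ((h.measurable_state r ((n + 1) * δ)).sub (h.measurable_state r (n * δ))).const_smul (δ : ℝ)⁻¹

theorem measurable_euclidean_apply {g : Ω → EuclideanSpace ℝ (Fin d)} (hg : Measurable g)
    (k : Fin d) : Measurable fun ω => g ω k := by
  fun_prop

theorem IsTrajectorySample.measurable_transition (h : IsTrajectorySample f σ μ P ℱ B X)
    (r : Fin M) (a : ℝ≥0) :
    Measurable fun ω => (X r a ω, X r (a + δ) ω, B r (a + δ) ω - B r a ω) :=
  (h.measurable_state r _).prodMk ((h.measurable_state r _).prodMk
    (((h.solution r).brownian.measurable _).sub ((h.solution r).brownian.measurable _)))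

/-- By stationarity and uniqueness in law of the solutions, all the observed transitions have the
same law. -/
theorem IsTrajectorySample.map_transition [IsProbabilityMeasure P]
    (h : IsTrajectorySample f σ μ P ℱ B X)
    (hf : LocallyLipschitz f) (hμ : IsInvariantLaw.{u} f σ μ) (hδ : 0 < δ) (r r' : Fin M)
    (a a' : ℝ≥0) :
    P.map (fun ω => (X r a ω, X r (a + δ) ω, B r (a + δ) ω - B r a ω)) =
      P.map (fun ω => (X r' a' ω, X r' (a' + δ) ω, B r' (a' + δ) ω - B r' a' ω)) := by
  refine map_transition_eq (h.solution r) (h.solution r') hf ?_ hδ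
  rw [hμ Ω mΩ P ‹_› _ _ _ (h.solution r) (h.initial r) a,
    hμ Ω mΩ P ‹_› _ _ _ (h.solution r') (h.initial r') a']

theorem IsTrajectorySample.measurable_error (h : IsTrajectorySample f σ μ P ℱ B X)
    (hF : Parametrizes φ F) (hδ : 0 < δ) (r : Fin M) (n : ℕ) :
    Measurable fun ω => flowIncrement (X r) δ n ω -
      F δ (X r (n * δ) ω) (noiseIncrement (B r) δ n ω) := by
  exact (h.measurable_flowIncrement r n).sub ((hF.measurable hδ).comp
    ((h.measurable_state r _).prodMk (h.measurable_noiseIncrement r n)))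

/-- The error is a measurable function `g` of the transition triple, whose law is common to all
trajectories and times. -/
theorem IsTrajectorySample.oneStepErrorCoord_eq [IsProbabilityMeasure P]
    (h : IsTrajectorySample f σ μ P ℱ B X)
    (hf : LocallyLipschitz f) (hμ : IsInvariantLaw.{u} f σ μ) (hF : Parametrizes φ F)
    (hδ : 0 < δ) (r r' : Fin M) (n n' : ℕ) (k : Fin d) :
    oneStepErrorCoord F P (B r) (X r) δ n k = oneStepErrorCoord F P (B r') (X r') δ n' k := by
  let g : EuclideanSpace ℝ (Fin d) × EuclideanSpace ℝ (Fin d) × EuclideanSpace ℝ (Fin m) →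
      ℝ≥0∞ := fun z => ‖((δ : ℝ)⁻¹ • (z.2.1 - z.1) - F δ z.1 z.2.2) k‖ₑ ^ 2
  have hg : Measurable g := by
    have h3 : Measurable fun z : EuclideanSpace ℝ (Fin d) × EuclideanSpace ℝ (Fin d) ×
        EuclideanSpace ℝ (Fin m) => F δ z.1 z.2.2 :=
      (hF.measurable hδ).comp (measurable_fst.prodMk (measurable_snd.comp measurable_snd))
    have h4 : Measurable fun z : EuclideanSpace ℝ (Fin d) × EuclideanSpace ℝ (Fin d) ×
        EuclideanSpace ℝ (Fin m) => (δ : ℝ)⁻¹ • (z.2.1 - z.1) := by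
      fun_prop
    have h5 := measurable_euclidean_apply (h4.sub h3) k
    exact h5.enorm.pow_const 2
  have key : ∀ (r : Fin M) (n : ℕ), oneStepErrorCoord F P (B r) (X r) δ n k =
      ∫⁻ z, g z ∂P.map (fun ω => (X r (n * δ) ω, X r (n * δ + δ) ω,
        B r (n * δ + δ) ω - B r (n * δ) ω)) := fun r n => by
    rw [lintegral_map hg (h.measurable_transition r _), oneStepErrorCoord]
    simp only [flowIncrement, noiseIncrement, add_one_mul]
    rfl
  rw [key, key, h.map_transition hf hμ hδ r r']

theorem IsTrajectorySample.oneStepError_eq_sum (h : IsTrajectorySample f σ μ P ℱ B X)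
    (hF : Parametrizes φ F) (hδ : 0 < δ) (r : Fin M) (n : ℕ) :
    oneStepError F P (B r) (X r) δ n = ∑ k, oneStepErrorCoord F P (B r) (X r) δ n k := by
  have h1 := h.measurable_error hF hδ r n
  have h2 : ∀ k, Measurable fun ω => ‖(flowIncrement (X r) δ n ω -
      F δ (X r (n * δ) ω) (noiseIncrement (B r) δ n ω)) k‖ₑ ^ 2 := fun k => by
    have h3 : Measurable fun ω => (flowIncrement (X r) δ n ω -
      F δ (X r (n * δ) ω) (noiseIncrement (B r) δ n ω)) k := by fun_prop
    exact h3.enorm.pow_const 2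
  simp only [oneStepErrorCoord]
  rw [← lintegral_finsetSum _ fun k _ => h2 k, oneStepError]
  refine lintegral_congr fun ω => ?_
  simp only [enorm_sq_eq_ofReal_sq]
  rw [← ofReal_norm, ← ENNReal.ofReal_pow (norm_nonneg _), EuclideanSpace.real_norm_sq_eq,
    ENNReal.ofReal_sum_of_nonneg fun _ _ => sq_nonneg _]

theorem IsTrajectorySample.measurable_residualVarianceCoord
    (h : IsTrajectorySample f σ μ P ℱ B X) (hF : Parametrizes φ F) (hδ : 0 < δ) (hM : 0 < M)
    (hN : 0 < N) (k : Fin d) : Measurable (residualVarianceCoord φ B X δ N k) := by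
  rw [funext (residualVarianceCoord_eq φ B X hδ k)]
  refine (measurable_residualSumSq_of_forall_le _ _ (fun z i => ?_) (fun z => ?_)
    fun ω c => estimator_minimizes φ B X hM hN k ω c).const_mul _
  · exact measurable_euclidean_apply (((hF δ hδ).1 i).comp
      ((h.measurable_state z.1 _).prodMk (h.measurable_noiseIncrement z.1 z.2))) k
  · exact measurable_euclidean_apply (h.measurable_flowIncrement z.1 z.2) k

theorem IsTrajectorySample.measurable_residualVariance
    (h : IsTrajectorySample f σ μ P ℱ B X) (hF : Parametrizes φ F) (hδ : 0 < δ) (hM : 0 < M)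
    (hN : 0 < N) : Measurable (residualVariance φ B X δ N) := by
  rw [funext (residualVariance_eq_sum φ B X)]
  exact Finset.measurable_sum _ fun k _ =>
    (h.measurable_residualVarianceCoord hF hδ hM hN k).const_mul _

theorem IsTrajectorySample.lintegral_residualVarianceCoord_le [IsProbabilityMeasure P]
    (h : IsTrajectorySample f σ μ P ℱ B X) (hf : LocallyLipschitz f)
    (hμ : IsInvariantLaw.{u} f σ μ) (hF : Parametrizes φ F) (hδ : 0 < δ) (hM : 0 < M)
    (hN : 0 < N) (k : Fin d) (r : Fin M) (n : ℕ) :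
    ∫⁻ ω, ENNReal.ofReal (residualVarianceCoord φ B X δ N k ω) ∂P
      ≤ oneStepErrorCoord F P (B r) (X r) δ n k := by
  obtain ⟨-, c, hc⟩ := hF δ hδ
  have hw : 0 < (M : ℝ) * N := by positivity
  let e : Fin M × ℕ → Ω → ℝ := fun z ω => (flowIncrement (X z.1) δ z.2 ω -
    F δ (X z.1 (z.2 * δ) ω) (noiseIncrement (B z.1) δ z.2 ω)) k
  have he : ∀ z, Measurable (e z) := fun z => by
    have := h.measurable_error hF hδ z.1 z.2
    fun_prop
  -- Pathwise comparison of the estimator with the deterministic coefficients `c` of the explicit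
  -- scheme.
  have hpt : ∀ ω, ENNReal.ofReal (residualVarianceCoord φ B X δ N k ω) ≤
      ENNReal.ofReal (1 / ((M : ℝ) * N)) * ∑ z ∈ sampleIndex M N, ‖e z ω‖ₑ ^ 2 := by
    intro ω
    rw [residualVarianceCoord_eq φ B X hδ, ENNReal.ofReal_mul (by positivity)]
    gcongr
    simp only [enorm_sq_eq_ofReal_sq]
    rw [← ENNReal.ofReal_sum_of_nonneg fun _ _ => sq_nonneg _]
    refine ENNReal.ofReal_le_ofReal ?_
    refine (estimator_minimizes φ B X hM hN k ω fun i => c i k).trans_eq ?_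
    refine Finset.sum_congr rfl fun z _ => ?_
    simp only [e, PiLp.sub_apply, hc]
    rfl
  calc ∫⁻ ω, ENNReal.ofReal (residualVarianceCoord φ B X δ N k ω) ∂P
      ≤ ∫⁻ ω, ENNReal.ofReal (1 / ((M : ℝ) * N)) *
          ∑ z ∈ sampleIndex M N, ‖e z ω‖ₑ ^ 2 ∂P := lintegral_mono hpt
    _ = ENNReal.ofReal (1 / ((M : ℝ) * N)) *
          ∑ z ∈ sampleIndex M N, oneStepErrorCoord F P (B z.1) (X z.1) δ z.2 k := by
        rw [lintegral_const_mul _ (Finset.measurable_sum _ fun z _ => (he z).enorm.pow_const 2),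
          lintegral_finsetSum _ fun z _ => (he z).enorm.pow_const 2]
        rfl
    -- All terms equal the one at `(r, n)`, and the sample has exactly `M * N` of them. The index
    -- `n` itself need not belong to the sample.
    _ = ENNReal.ofReal (1 / ((M : ℝ) * N)) * ENNReal.ofReal ((M : ℝ) * N) *
          oneStepErrorCoord F P (B r) (X r) δ n k := by
        rw [Finset.sum_congr rfl fun z _ => h.oneStepErrorCoord_eq hf hμ hF hδ z.1 r z.2 n k,
          Finset.sum_const, mul_assoc]
        congr 1
        rw [nsmul_eq_mul, ENNReal.ofReal_mul (by positivity)]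
        simp [sampleIndex]
    _ = oneStepErrorCoord F P (B r) (X r) δ n k := by
        rw [← ENNReal.ofReal_mul (by positivity), one_div_mul_cancel hw.ne', ENNReal.ofReal_one,
          one_mul]

theorem IsTrajectorySample.lintegral_residualVariance_le [IsProbabilityMeasure P]
    (h : IsTrajectorySample f σ μ P ℱ B X) (hd : 0 < d) (hf : LocallyLipschitz f)
    (hμ : IsInvariantLaw.{u} f σ μ) (hF : Parametrizes φ F) (hδ : 0 < δ) (hM : 0 < M)
    (hN : 0 < N) (r : Fin M) (n : ℕ) :
    ∫⁻ ω, ENNReal.ofReal (residualVariance φ B X δ N ω) ∂P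
      ≤ 2 / (d : ℝ≥0∞) * oneStepError F P (B r) (X r) δ n := by
  have hmeas := h.measurable_residualVarianceCoord hF hδ hM hN
  have hnn : ∀ k ω, 0 ≤ residualVarianceCoord φ B X δ N k ω := fun k ω => by
    rw [residualVarianceCoord]
    exact mul_nonneg (by positivity)
      (Finset.sum_nonneg fun _ _ => Finset.sum_nonneg fun _ _ => sq_nonneg _)
  have h2d : ENNReal.ofReal (2 / (d : ℝ)) = 2 / (d : ℝ≥0∞) := by
    rw [ENNReal.ofReal_div_of_pos (by exact_mod_cast hd)]
    simp
  have hpt : ∀ ω, ENNReal.ofReal (residualVariance φ B X δ N ω) =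
      2 / (d : ℝ≥0∞) * ∑ k, ENNReal.ofReal (residualVarianceCoord φ B X δ N k ω) := fun ω => by
    rw [residualVariance_eq_sum, ← Finset.mul_sum, ENNReal.ofReal_mul (by positivity), h2d,
      ENNReal.ofReal_sum_of_nonneg fun k _ => hnn k ω]
  simp only [hpt]
  rw [lintegral_const_mul _ (Finset.measurable_sum _ fun k _ => (hmeas k).ennreal_ofReal),
    lintegral_finsetSum _ fun k _ => (hmeas k).ennreal_ofReal, h.oneStepError_eq_sum hF hδ]
  gcongr with k
  exact h.lintegral_residualVarianceCoord_le hf hμ hF hδ hM hN k r n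

end Sample

theorem theorem3 {d m M : ℕ} (hd : 0 < d) (hM : 0 < M)
    (f : EuclideanSpace ℝ (Fin d) → EuclideanSpace ℝ (Fin d)) (hf : LocallyLipschitz f)
    (σ : Matrix (Fin d) (Fin m) ℝ)
    (μ : Measure (EuclideanSpace ℝ (Fin d))) (hμ : IsInvariantLaw.{u} f σ μ)
    {Ω : Type u} [mΩ : MeasurableSpace Ω] (P : Measure Ω) [IsProbabilityMeasure P]
    (ℱ : Fin M → Filtration ℝ≥0 mΩ)
    (B : Fin M → ℝ≥0 → Ω → EuclideanSpace ℝ (Fin m))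
    (X : Fin M → ℝ≥0 → Ω → EuclideanSpace ℝ (Fin d))
    (hdata : IsTrajectorySample f σ μ P ℱ B X) :
    -- IS-EM and IS-RK4 are parametrizations of their explicit schemes
    Parametrizes (emBasis f σ) (emFlow f σ) ∧
    Parametrizes (rk4Basis f σ) (rk4Increment f σ) ∧
    Parametrizes (rk4Basis f σ) (rk4AddNoiseFlow f σ) ∧
    ∀ (p : ℕ) (φ : Fin (p + 1) → FlowMap d m) (F : FlowMap d m), Parametrizes φ F →
      -- the residual of the inferred scheme is controlled by that of the explicit scheme
      (∀ (δ : ℝ≥0) (N : ℕ), 0 < δ → 0 < N →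
        (∀ k : Fin d, AEMeasurable (residualVarianceCoord φ B X δ N k) P ∧
          ∀ (r : Fin M) (n : ℕ),
            ∫⁻ ω, ENNReal.ofReal (residualVarianceCoord φ B X δ N k ω) ∂P
              ≤ oneStepErrorCoord F P (B r) (X r) δ n k) ∧
        AEMeasurable (residualVariance φ B X δ N) P ∧
        ∀ (r : Fin M) (n : ℕ),
          ∫⁻ ω, ENNReal.ofReal (residualVariance φ B X δ N ω) ∂P
            ≤ 2 / (d : ℝ≥0∞) * oneStepError F P (B r) (X r) δ n) ∧
      -- the inferred scheme inherits the one-step strong order of the explicit scheme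
      (∀ (γ : ℝ) (r : Fin M) (n : ℕ) (N : ℝ≥0 → ℕ), (∀ δ, 0 < N δ) →
        HasOneStepStrongOrder (fun δ => oneStepError F P (B r) (X r) δ n) γ →
        HasOneStepStrongOrder
          (fun δ => ∫⁻ ω, ENNReal.ofReal (residualVariance φ B X δ (N δ) ω) ∂P) γ) := by
  refine ⟨parametrizes_emBasis hf.continuous σ, parametrizes_rk4Basis hf.continuous σ,
    parametrizes_rk4Basis_addNoise hf.continuous σ, fun p φ F hF => ⟨fun δ N hδ hN =>
      ⟨fun k => ⟨(hdata.measurable_residualVarianceCoord hF hδ hM hN k).aemeasurable,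
        hdata.lintegral_residualVarianceCoord_le hf hμ hF hδ hM hN k⟩,
      (hdata.measurable_residualVariance hF hδ hM hN).aemeasurable,
      hdata.lintegral_residualVariance_le hd hf hμ hF hδ hM hN⟩, ?_⟩⟩
  rintro γ r n N hN ⟨C, hC⟩
  -- The order is expressed through mean squares, so `2 / d` multiplies the constant without a root.
  -- The bound does not depend on the sample length, which may thus vary with `δ`.
  refine ⟨2 / d * C, ?_⟩
  filter_upwards [hC, self_mem_nhdsWithin] with δ hCδ hδ
  have hd' : (d : ℝ≥0) ≠ 0 := by exact_mod_cast hd.ne'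
  refine (hdata.lintegral_residualVariance_le hd hf hμ hF hδ hM (hN δ) r n).trans ?_
  calc 2 / (d : ℝ≥0∞) * oneStepError F P (B r) (X r) δ n
      ≤ 2 / (d : ℝ≥0∞) * ((C * δ ^ (2 * γ) : ℝ≥0) : ℝ≥0∞) := by gcongr
    _ = ((2 / d * C * δ ^ (2 * γ) : ℝ≥0) : ℝ≥0∞) := by
        rw [mul_assoc, ENNReal.coe_mul (2 / (d : ℝ≥0)), ENNReal.coe_div hd']
        simp
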